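/- Let $p\ge 1$, $q,n,m\ge 0$ be integers, $X=\mathbb{R}^p$, $U=\mathbb{R}^q$. For $k\ge 0$ let $J^k$ be the jet space of order $k$ with coordinates $x^i$ ($1\le i\le p$) and $u^\alpha_J$ ($1\le\alpha\le q$, $J\in\mathbb{N}^p$ an unordered multi-index with $|J|\le k$), and write $u^{(k)}=(u^\alpha_J)_{|J|\le k}$. On smooth functions of $x$, $u$ and finitely many derivatives $u^\alpha_J$ define the total derivatives $$D_i=\frac{\partial}{\partial x^i}+\sum_{\alpha=1}^q\sum_J u^\alpha_{J+e_i}\frac{\partial}{\partial u^\alpha_J},\qquad (-D)_J=(-1)^{|J|}D_1^{J_1}\cdots D_p^{J_p},$$ the Euler operator $E=(E_1,\dots,E_q)$ with $E_\alpha=\sum_J(-D)_J\,\partial/\partial u^\alpha_J$, and, for a $p$-tuple $P$, the total divergence $\mathrm{Div}\,P=\sum_{i=1}^pD_iP_i$. For functions on a product of two jet spaces, $E^1$ and $E^2$ denote the Euler operator acting on the first and on the second jet, respectively, the other jet being kept fixed. Let $\Omega\subset X$ be open (for instance a connected region with smooth boundary) and let $L_{12}=L_{12}(x,u^{(n)},y,v^{(m)}):J^n\times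 J^m\to\mathbb{R}$ be a smooth non-local Lagrangian. For a smooth field $\phi:\Omega\to U$ with prolongation $\phi^{(k)}$ (the tuple of all partial derivatives of $\phi$ of order at most $k$), the partial integral of a function $F(x,u,\dots;y,v,\dots)$ on pairs of jets along $\phi$ in the first argument is the function of the second jet $$\mathcal{I}^1_\Omega(F)=\int_\Omega F\,\big|_{u_J=\partial_J\phi(x)}\,dx ,$$ and $\mathcal{I}^2_\Omega(F)$, a function of the first jet, is defined likewise by inserting $\phi$ in the second argument and integrating over $y\in\Omega$. Call a smooth $\phi:\Omega\to U$ admissible for $\mathcal{I}^1_\Omega$ if for every $r\ge0$ and every compact $K\subset J^m$ there is an integrable function $g$ on $\Omega$ such that all derivatives of order $r$ of $L_{12}(x,\phi^{(n)}(x),\,\cdot\,)$ with respect to the second jet are bounded by $g(x)$ on $K$, for all $x\in\Omega$; admissibility for $\mathcal{I}^2_\Omega$ is defined in the same way with the two arguments exchanged. (If $\Omega$ is bounded, every restriction to $\Omega$ of a smooth function $\mathbb{R}^p\to U$ is admissible for both.) Then the following are equivalent. 1. $\mathcal{I}^2_\Omega(E^1_\alpha(L_{12}))=0$ for all $\alpha$,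 for every field admissible for $\mathcal{I}^2_\Omega$ and at all jets with base point in $\Omega$; and $\mathcal{I}^1_\Omega(E^2_\alpha(L_{12}))=0$ for all $\alpha$, for every field admissible for $\mathcal{I}^1_\Omega$ and at all jets with base point in $\Omega$. 2. For every field admissible for $\mathcal{I}^2_\Omega$ there is a $p$-tuple $P^1$, and for every field admissible for $\mathcal{I}^1_\Omega$ there is a $p$-tuple $P^2$, of smooth functions of a base point in $\Omega$, the field coordinates and finitely many of their derivative coordinates, such that $$\mathcal{I}^2_\Omega(L_{12})=\mathrm{Div}\,P^1\qquad\text{and}\qquad\mathcal{I}^1_\Omega(L_{12})=\mathrm{Div}\,P^2,$$ respectively, at all jets with base point in $\Omega$. (Since the partial integrals depend on the field that is integrated out, so do $P^1$ and $P^2$.) -/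

import Mathlib

open scoped ContDiff
open MeasureTheory

noncomputable section

namespace NonlocalLagrangian

/-- Jets of infinite order of functions `u : ℝ^p → ℝ^q`: a base point `x` together with a value
`u_J^α` for every multi-index `J` and every component `α`.  The multi-index `J : Fin p → ℕ` stands
for the partial derivative `∂^{|J|} / ∏ i (∂ x^i)^{J i}`.  All functions considered on this space
depend on finitely many coordinates only (they factor through some `FinJet p q k`). -/
abbrev Jet (p q : ℕ) : Type := (Fin p → ℝ) × ((Fin p → ℕ) → Fin q → ℝ)

/-- Multi-indices of order at most `k`. -/
abbrev MultiIndex (p k : ℕ) : Type := {J : Fin p → ℕ // ∑ i, J i ≤ k}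

instance (p k : ℕ) : Finite (MultiIndex p k) :=
  Finite.of_injective
    (fun (J : MultiIndex p k) (i : Fin p) =>
      (⟨J.1 i, Nat.lt_succ_of_le
        ((Finset.single_le_sum (fun j _ => Nat.zero_le (J.1 j)) (Finset.mem_univ i)).trans
          J.2)⟩ : Fin (k + 1)))
    (fun _ _ h => Subtype.ext (funext fun i => congrArg Fin.val (congrFun h i)))

instance (p k : ℕ) : Fintype (MultiIndex p k) := Fintype.ofFinite _

/-- The jet space `J^k` of order `k` over `ℝ^p × ℝ^q`. -/
abbrev FinJet (p q k : ℕ) : Type := (Fin p → ℝ) × (MultiIndex p k → Fin q → ℝ)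

/-- The projection of a jet to its part of order at most `k`. -/
def trunc {p q : ℕ} (k : ℕ) (z : Jet p q) : FinJet p q k := (z.1, fun J => z.2 J.1)

/-- For operators `T 1, …, T p`, the composition `(T 1)^(J 1) ∘ ⋯ ∘ (T p)^(J p)`. -/
def iterOp {p : ℕ} {A : Type} (T : Fin p → A → A) (J : Fin p → ℕ) : A → A :=
  (List.finRange p).foldr (fun i G => (T i)^[J i] ∘ G) id

/-- The partial derivative `∂φ/∂x^i` of a field. -/
def partialDeriv {p q : ℕ} (i : Fin p) (φ : (Fin p → ℝ) → (Fin q → ℝ)) :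
    (Fin p → ℝ) → (Fin q → ℝ) :=
  fun x => lineDeriv ℝ φ x (Pi.single i 1)

/-- The prolongation of the field `φ`: the jet at `x` of all partial derivatives of `φ`. -/
def prolong {p q : ℕ} (φ : (Fin p → ℝ) → (Fin q → ℝ)) (x : Fin p → ℝ) : Jet p q :=
  (x, fun J => iterOp partialDeriv J φ x)

/-- The coordinate derivative `∂F/∂x^i` on jets (explicit dependence on `x`). -/
def derivX {p q : ℕ} (i : Fin p) (F : Jet p q → ℝ) : Jet p q → ℝ :=
  fun z => lineDeriv ℝ F z (Pi.single i 1, 0)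

/-- The coordinate derivative `∂F/∂u_J^α` on jets. -/
def derivU {p q : ℕ} (J : Fin p → ℕ) (α : Fin q) (F : Jet p q → ℝ) : Jet p q → ℝ :=
  fun z => lineDeriv ℝ F z (0, Pi.single J (Pi.single α 1))

/-- The total derivative `D_i = ∂/∂x^i + ∑_α ∑_J u_{J,i}^α ∂/∂u_J^α`.  The sum over `J` has
finitely many nonzero terms, since the functions it is applied to are of finite order. -/
def totalDeriv {p q : ℕ} (i : Fin p) (F : Jet p q → ℝ) : Jet p q → ℝ :=
  fun z => derivX i F z + ∑ α : Fin q, ∑ᶠ J : Fin p → ℕ, z.2 (J + Pi.single i 1) α * derivU J α F z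

/-- The total divergence `Div P = D_1 P_1 + ⋯ + D_p P_p`. -/
def totalDiv {p q : ℕ} (P : Fin p → Jet p q → ℝ) : Jet p q → ℝ :=
  fun z => ∑ i, totalDeriv i (P i) z

/-- The `α`-th component `E_α = ∑_J (-D)_J ∂/∂u_J^α` of the Euler operator. -/
def euler {p q : ℕ} (α : Fin q) (F : Jet p q → ℝ) : Jet p q → ℝ :=
  fun z => ∑ᶠ J : Fin p → ℕ, (-1) ^ (∑ i, J i) * iterOp totalDeriv J (derivU J α F) z

/-- A Lagrangian on `J^n × J^m`, regarded as a function of a pair of jets. -/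
def lift {p q n m : ℕ} (L : FinJet p q n × FinJet p q m → ℝ) : Jet p q → Jet p q → ℝ :=
  fun z w => L (trunc n z, trunc m w)

/-- The Euler operator `E^1` of the first jet space. -/
def euler₁ {p q : ℕ} (α : Fin q) (F : Jet p q → Jet p q → ℝ) : Jet p q → Jet p q → ℝ :=
  fun z w => euler α (fun z' => F z' w) z

/-- The Euler operator `E^2` of the second jet space. -/
def euler₂ {p q : ℕ} (α : Fin q) (F : Jet p q → Jet p q → ℝ) : Jet p q → Jet p q → ℝ :=
  fun z w => euler α (fun w' => F z w') w

/-- The partial integral `I^1_Ω(F)` along the field `φ` in the first argument, a function of the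
jet in the second argument. -/
def integral₁ {p q : ℕ} (Ω : Set (Fin p → ℝ)) (φ : (Fin p → ℝ) → (Fin q → ℝ))
    (F : Jet p q → Jet p q → ℝ) : Jet p q → ℝ :=
  fun w => ∫ x in Ω, F (prolong φ x) w

/-- The partial integral `I^2_Ω(F)` along the field `φ` in the second argument, a function of the
jet in the first argument. -/
def integral₂ {p q : ℕ} (Ω : Set (Fin p → ℝ)) (φ : (Fin p → ℝ) → (Fin q → ℝ))
    (F : Jet p q → Jet p q → ℝ) : Jet p q → ℝ :=
  fun z => ∫ y in Ω, F z (prolong φ y)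

/-- The parameter integral `∫_Ω G(x, ·) dx` converges absolutely and locally uniformly, together
with the integrals of all derivatives of `G` in the parameter. -/
def LocallyDominated {p : ℕ} {E : Type} [NormedAddCommGroup E] [NormedSpace ℝ E]
    (Ω : Set (Fin p → ℝ)) (G : (Fin p → ℝ) → E → ℝ) : Prop :=
  ∀ (r : ℕ) (K : Set E), IsCompact K → ∃ g : (Fin p → ℝ) → ℝ, IntegrableOn g Ω ∧
    ∀ x ∈ Ω, ∀ w ∈ K, ‖iteratedFDeriv ℝ r (G x) w‖ ≤ g x

/-- Smooth fields on `Ω` along which `L` can be integrated in its first argument. -/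
def Admissible₁ {p q n m : ℕ} (Ω : Set (Fin p → ℝ)) (L : FinJet p q n × FinJet p q m → ℝ)
    (φ : (Fin p → ℝ) → (Fin q → ℝ)) : Prop :=
  ContDiffOn ℝ ∞ φ Ω ∧ LocallyDominated Ω (fun x w => L (trunc n (prolong φ x), w))

/-- Smooth fields on `Ω` along which `L` can be integrated in its second argument. -/
def Admissible₂ {p q n m : ℕ} (Ω : Set (Fin p → ℝ)) (L : FinJet p q n × FinJet p q m → ℝ)
    (φ : (Fin p → ℝ) → (Fin q → ℝ)) : Prop :=
  ContDiffOn ℝ ∞ φ Ω ∧ LocallyDominated Ω (fun y z => L (z, trunc m (prolong φ y)))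

/-- Over `Ω`, the function `F` is the total divergence of a `p`-tuple of smooth functions of the
base point, the field and finitely many of its derivatives. -/
def IsTotalDivOver {p q : ℕ} (Ω : Set (Fin p → ℝ)) (F : Jet p q → ℝ) : Prop :=
  ∃ (k : ℕ) (P : Fin p → FinJet p q k → ℝ),
    (∀ i, ContDiffOn ℝ ∞ (P i) {z | z.1 ∈ Ω}) ∧
    ∀ z : Jet p q, z.1 ∈ Ω → F z = totalDiv (fun i z' => P i (trunc k z')) z

end NonlocalLagrangian

end

/-! The equivalence already holds for each admissible field separately, and the second half is the
first with the two arguments exchanged. Fix a field φ and let G be the partial integral of L along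
it. Admissibility permits differentiation under the integral sign, so G is a smooth function of
finitely many jet coordinates and its Euler expressions are the partial integrals of those of L
(`IsParamLocal.euler_integral`). What remains is the classical fact that the kernel of the Euler
operator consists of the total divergences.

Divergences are killed because [∂/∂u_J, D_i] = ∂/∂u_{J-e_i} makes the alternating sum telescope
(`euler_totalD`); since P is smooth only over Ω, a cutoff near each base point comes first
(`IsTotalDivOver.euler_eq_zero`). Conversely, integrate the derivative of G along the ray t ↦ (x,
tu). Integration by parts turns G(x,u) - G(x,0) into u^α times means of E_α(G), which vanish, plus a
divergence. The remainder G(x,0) is D_i of an antiderivative in one base coordinate, which is where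
p ≥ 1 enters. As L, hence G, is defined over all of ℝ^p, the shape of Ω plays no role
(`isTotalDivOver_of_euler_eq_zero`). -/

noncomputable section

namespace NonlocalLagrangian

/-! ### Smooth dependence of integrals on parameters -/

section ParametricIntegral

variable {Y : Type*} [MeasurableSpace Y] {μ : Measure Y}
  {C : Type*} [NormedAddCommGroup C] [NormedSpace ℝ C]
  {E : Type*} [NormedAddCommGroup E] [NormedSpace ℝ E]
  {E' : Type*} [NormedAddCommGroup E'] [NormedSpace ℝ E']
  {F : Type*} [NormedAddCommGroup F] [NormedSpace ℝ F]

/-- The derivatives of all orders of `G y` are bounded on compact sets by integrable functions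
of the parameter `y`. -/
def Dominated (μ : Measure Y) (G : Y → E → ℝ) : Prop :=
  ∀ (r : ℕ) (K : Set E), IsCompact K → ∃ g : Y → ℝ, Integrable g μ ∧
    ∀ᵐ y ∂μ, ∀ w ∈ K, ‖iteratedFDeriv ℝ r (G y) w‖ ≤ g y

theorem contDiff_slice {g : E × C → F} (hg : ContDiff ℝ ∞ g) (c : C) :
    ContDiff ℝ ∞ (fun z => g (z, c)) :=
  hg.comp (contDiff_id.prodMk contDiff_const)

theorem fderiv_slice {g : E × C → F} (hg : ContDiff ℝ ∞ g) (z : E) (c : C) :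
    fderiv ℝ (fun w => g (w, c)) z = (fderiv ℝ g (z, c)).comp (ContinuousLinearMap.inl ℝ E C) := by
  have h := (hg.differentiable (by simp) (z, c)).hasFDerivAt
  exact (h.comp z (hasFDerivAt_prodMk_left z c)).fderiv

theorem contDiff_fderiv_slice {g : E × C → F} (hg : ContDiff ℝ ∞ g) :
    ContDiff ℝ ∞ (fun w : E × C => fderiv ℝ (fun z => g (z, w.2)) w.1) := by
  have : (fun w : E × C => fderiv ℝ (fun z => g (z, w.2)) w.1)
      = fun w => (fderiv ℝ g w).comp (ContinuousLinearMap.inl ℝ E C) := by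
    ext1 w
    exact fderiv_slice hg w.1 w.2
  rw [this]
  exact (hg.fderiv_right (m := ∞) (by simp)).clm_comp contDiff_const

/-- A slice is a translate of `g` precomposed with the linear inclusion, and both operations have
known effect on iterated derivatives. Joint smoothness in point and parameter follows. -/
theorem iteratedFDeriv_slice {g : E × C → F} (hg : ContDiff ℝ ∞ g) (r : ℕ) (z : E) (c : C) :
    iteratedFDeriv ℝ r (fun w => g (w, c)) z =
      (iteratedFDeriv ℝ r g (z, c)).compContinuousLinearMap
        fun _ => ContinuousLinearMap.inl ℝ E C := by
  have h1 : ContDiff ℝ ∞ (fun w => g (w + (0, c))) := hg.comp (contDiff_id.add contDiff_const)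
  have h2 : (fun w => g (w, c)) = (fun w => g (w + (0, c))) ∘ ContinuousLinearMap.inl ℝ E C := by
    ext w
    simp
  rw [h2, ContinuousLinearMap.iteratedFDeriv_comp_right _ h1 z (i := r) (by exact_mod_cast le_top),
    iteratedFDeriv_comp_add_right]
  simp

theorem contDiff_iteratedFDeriv_slice {g : E × C → F} (hg : ContDiff ℝ ∞ g) (r : ℕ) :
    ContDiff ℝ ∞ (fun w : E × C => iteratedFDeriv ℝ r (fun z => g (z, w.2)) w.1) := by
  have : (fun w : E × C => iteratedFDeriv ℝ r (fun z => g (z, w.2)) w.1)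
      = fun w => ContinuousMultilinearMap.compContinuousLinearMapL (𝕜 := ℝ)
        (fun _ : Fin r => ContinuousLinearMap.inl ℝ E C) (iteratedFDeriv ℝ r g w) := by
    ext1 w
    exact iteratedFDeriv_slice hg r w.1 w.2
  rw [this]
  exact (ContinuousLinearMap.contDiff _).comp
    (hg.iteratedFDeriv_right (m := ∞) (i := r) (mod_cast le_top))

theorem aestronglyMeasurable_slice {g : E × C → F} (hg : ContDiff ℝ ∞ g) {c : Y → C}
    (hc : AEStronglyMeasurable c μ) (z : E) : AEStronglyMeasurable (fun y => g (z, c y)) μ :=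
  (hg.continuous.comp (Continuous.prodMk_right z)).comp_aestronglyMeasurable hc

/-- The derivative `f'` is pinned down only through its values on vectors, so that both the integral
of a derivative and the curried integral of the next iterated derivative fit. -/
theorem hasFDerivAt_integral_slice {g : E × C → F} (hg : ContDiff ℝ ∞ g) {c : Y → C}
    (hc : AEStronglyMeasurable c μ) (z : E) (hint : Integrable (fun y => g (z, c y)) μ)
    {b : Y → ℝ} (hb : Integrable b μ)
    (hle : ∀ᵐ y ∂μ, ∀ w ∈ Metric.closedBall z 1, ‖fderiv ℝ (fun w => g (w, c y)) w‖ ≤ b y)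
    {f' : E →L[ℝ] F} (hf' : ∀ v, Integrable (fun y => fderiv ℝ (fun w => g (w, c y)) z v) μ →
      f' v = ∫ y, fderiv ℝ (fun w => g (w, c y)) z v ∂μ) :
    HasFDerivAt (fun z => ∫ y, g (z, c y) ∂μ) f' z := by
  have hmeas := aestronglyMeasurable_slice (μ := μ) (contDiff_fderiv_slice hg) hc z
  have hi : Integrable (fun y => fderiv ℝ (fun w => g (w, c y)) z) μ :=
    hb.mono' hmeas (hle.mono fun y hy => hy z (Metric.mem_closedBall_self zero_le_one))
  have hf : f' = ∫ y, fderiv ℝ (fun w => g (w, c y)) z ∂μ := by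
    ext v
    rw [hf' v (hi.apply_continuousLinearMap v), ContinuousLinearMap.integral_apply hi]
  rw [hf]
  refine hasFDerivAt_integral_of_dominated_of_fderiv_le (𝕜 := ℝ) (s := Metric.closedBall z 1)
    (F := fun z y => g (z, c y)) (F' := fun z y => fderiv ℝ (fun w => g (w, c y)) z)
    (Metric.closedBall_mem_nhds z one_pos)
    (Filter.Eventually.of_forall fun w => aestronglyMeasurable_slice hg hc w) hint
    hmeas hle hb (Filter.Eventually.of_forall fun y w _ => ?_)
  exact ((contDiff_slice hg (c y)).differentiable (by simp) w).hasFDerivAt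

variable {g : E × C → ℝ} {c : Y → C}

theorem Dominated.integrable_iteratedFDeriv (hg : ContDiff ℝ ∞ g)
    (hc : AEStronglyMeasurable c μ) (hd : Dominated μ fun y z => g (z, c y)) (r : ℕ) (z : E) :
    Integrable (fun y => iteratedFDeriv ℝ r (fun w => g (w, c y)) z) μ := by
  obtain ⟨b, hb, hle⟩ := hd r {z} isCompact_singleton
  exact hb.mono' (aestronglyMeasurable_slice (contDiff_iteratedFDeriv_slice hg r) hc z)
    (hle.mono fun y hy => hy z rfl)

theorem Dominated.integrable (hg : ContDiff ℝ ∞ g)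
    (hc : AEStronglyMeasurable c μ) (hd : Dominated μ fun y z => g (z, c y)) (z : E) :
    Integrable (fun y => g (z, c y)) μ := by
  obtain ⟨b, hb, hle⟩ := hd 0 {z} isCompact_singleton
  refine hb.mono' (aestronglyMeasurable_slice hg hc z) (hle.mono fun y hy => ?_)
  simpa using hy z rfl

theorem Dominated.integrable_fderiv (hg : ContDiff ℝ ∞ g)
    (hc : AEStronglyMeasurable c μ) (hd : Dominated μ fun y z => g (z, c y)) (z : E) :
    Integrable (fun y => fderiv ℝ (fun w => g (w, c y)) z) μ := by
  obtain ⟨b, hb, hle⟩ := hd 1 {z} isCompact_singleton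
  refine hb.mono' (aestronglyMeasurable_slice (contDiff_fderiv_slice hg) hc z)
    (hle.mono fun y hy => ?_)
  simpa [norm_iteratedFDeriv_one] using hy z rfl

theorem Dominated.hasFDerivAt_integral [FiniteDimensional ℝ E] (hg : ContDiff ℝ ∞ g)
    (hc : AEStronglyMeasurable c μ) (hd : Dominated μ fun y z => g (z, c y)) (z : E) :
    HasFDerivAt (fun z => ∫ y, g (z, c y) ∂μ) (∫ y, fderiv ℝ (fun w => g (w, c y)) z ∂μ) z := by
  have := FiniteDimensional.proper ℝ E
  obtain ⟨b, hb, hle⟩ := hd 1 _ (isCompact_closedBall z 1)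
  refine hasFDerivAt_integral_slice hg hc z (hd.integrable hg hc z) hb
    (hle.mono fun y hy w hw => ?_)
    fun v _ => ContinuousLinearMap.integral_apply (hd.integrable_fderiv hg hc z) v
  simpa [norm_iteratedFDeriv_one] using hy w hw

/-- The integrals of the iterated derivatives form a Taylor series: each is the derivative of the
preceding one by dominated differentiation, and continuity comes with differentiability. -/
theorem Dominated.contDiff_integral [FiniteDimensional ℝ E] (hg : ContDiff ℝ ∞ g)
    (hc : AEStronglyMeasurable c μ) (hd : Dominated μ fun y z => g (z, c y)) :
    ContDiff ℝ ∞ (fun z => ∫ y, g (z, c y) ∂μ) := by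
  have := FiniteDimensional.proper ℝ E
  have key : ∀ (r : ℕ) (z : E),
      HasFDerivAt (fun z => ∫ y, iteratedFDeriv ℝ r (fun w => g (w, c y)) z ∂μ)
        (∫ y, iteratedFDeriv ℝ (r + 1) (fun w => g (w, c y)) z ∂μ).curryLeft z := by
    intro r z
    obtain ⟨b, hb, hle⟩ := hd (r + 1) _ (isCompact_closedBall z 1)
    refine hasFDerivAt_integral_slice (contDiff_iteratedFDeriv_slice hg r) hc z
      (hd.integrable_iteratedFDeriv hg hc r z) hb (hle.mono fun y hy w hw => by
        simpa only [norm_fderiv_iteratedFDeriv] using hy w hw) fun v h => ?_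
    ext m
    have hi := hd.integrable_iteratedFDeriv hg hc (r + 1) z
    rw [ContinuousMultilinearMap.curryLeft_apply, ContinuousMultilinearMap.integral_apply hi,
      ContinuousMultilinearMap.integral_apply h]
    simp [iteratedFDeriv_succ_apply_left]
  have hT : HasFTaylorSeriesUpTo ∞ (fun z => ∫ y, g (z, c y) ∂μ)
      (fun z r => ∫ y, iteratedFDeriv ℝ r (fun w => g (w, c y)) z ∂μ) := by
    refine ⟨fun z => ?_, fun r _ z => key r z, fun r _ => ?_⟩
    · have h := ((continuousMultilinearCurryFin0 ℝ E
        ℝ).toContinuousLinearEquiv.toContinuousLinearMap).integral_comp_comm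
        (hd.integrable_iteratedFDeriv hg hc 0 z)
      simpa using h.symm
    · exact continuous_iff_continuousAt.2 fun z => (key r z).continuousAt
  exact hT.contDiff

/-- The derivative of the slices of `g` along a vector field, pulled back by a linear map. -/
def sliceDeriv (π : E' →L[ℝ] E) (V : E' → E) (g : E × C → ℝ) : E' × C → ℝ :=
  fun w => fderiv ℝ (fun z => g (z, w.2)) (π w.1) (V w.1)

theorem contDiff_sliceDeriv (π : E' →L[ℝ] E) {V : E' → E} (hV : ContDiff ℝ ∞ V)
    (hg : ContDiff ℝ ∞ g) : ContDiff ℝ ∞ (sliceDeriv π V g) := by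
  have h1 : ContDiff ℝ ∞ (fun w : E' × C => (π w.1, w.2)) :=
    (π.contDiff.comp contDiff_fst).prodMk contDiff_snd
  exact ((contDiff_fderiv_slice hg).comp h1).clm_apply (hV.comp contDiff_fst)

/-- By the Leibniz formula, derivatives of the new family are bounded by sums of integrable bounds
for `g` on π(K) times suprema of derivatives of `V` on `K`. Domination thus survives the coordinate
and total derivatives. -/
theorem Dominated.sliceDeriv (π : E' →L[ℝ] E) {V : E' → E} (hV : ContDiff ℝ ∞ V)
    (hg : ContDiff ℝ ∞ g) (hd : Dominated μ fun y z => g (z, c y)) :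
    Dominated μ fun y z => sliceDeriv π V g (z, c y) := by
  intro r K hK
  choose b hb hle using fun i => hd (i + 1) (π '' K) (hK.image π.continuous)
  have hB : ∀ i : ℕ, ∃ B : ℝ, ∀ w ∈ K, ‖iteratedFDeriv ℝ i V w‖ ≤ B := fun i =>
    hK.exists_bound_of_continuousOn
      (hV.continuous_iteratedFDeriv (m := i) (by exact_mod_cast le_top)).continuousOn
  choose B hB using hB
  refine ⟨fun y => ∑ i ∈ Finset.range (r + 1), r.choose i * (b i y * ‖π‖ ^ i) * B (r - i),
    integrable_finsetSum _ fun i _ => (((hb i).mul_const _).const_mul _).mul_const _, ?_⟩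
  filter_upwards [ae_all_iff.2 hle] with y hy w hw
  have hgy := contDiff_slice hg (c y)
  have hf : ContDiff ℝ ∞ (fderiv ℝ (fun z => g (z, c y))) := hgy.fderiv_right (by simp)
  refine (norm_iteratedFDeriv_clm_apply (hf.comp π.contDiff) hV w
    (n := r) (by exact_mod_cast le_top)).trans ?_
  refine Finset.sum_le_sum fun i _ => ?_
  have h1 : ‖iteratedFDeriv ℝ i (fderiv ℝ (fun z => g (z, c y)) ∘ π) w‖ ≤ b i y * ‖π‖ ^ i := by
    rw [ContinuousLinearMap.iteratedFDeriv_comp_right _ hf w (i := i) (by exact_mod_cast le_top)]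
    refine (ContinuousMultilinearMap.norm_compContinuousLinearMap_le _ _).trans ?_
    rw [norm_iteratedFDeriv_fderiv]
    simp only [Finset.prod_const, Finset.card_univ, Fintype.card_fin]
    exact mul_le_mul_of_nonneg_right (hy i _ ⟨w, hw, rfl⟩) (by positivity)
  have h2 := hB (r - i) w hw
  have h3 := (norm_nonneg _).trans h1
  gcongr

theorem Dominated.fderiv_integral_apply [FiniteDimensional ℝ E] (hg : ContDiff ℝ ∞ g)
    (hc : AEStronglyMeasurable c μ) (hd : Dominated μ fun y z => g (z, c y)) (z v : E) :
    fderiv ℝ (fun z => ∫ y, g (z, c y) ∂μ) z v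
      = ∫ y, fderiv ℝ (fun w => g (w, c y)) z v ∂μ := by
  rw [(hd.hasFDerivAt_integral hg hc z).fderiv,
    ContinuousLinearMap.integral_apply (hd.integrable_fderiv hg hc z)]

theorem dominated_of_isCompact [IsFiniteMeasure μ] (hg : ContDiff ℝ ∞ g) {S : Set C}
    (hS : IsCompact S) (hc : ∀ᵐ y ∂μ, c y ∈ S) : Dominated μ fun y z => g (z, c y) := by
  intro r K hK
  obtain ⟨B, hB⟩ := (hK.prod hS).exists_bound_of_continuousOn
    (contDiff_iteratedFDeriv_slice hg r).continuous.continuousOn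
  exact ⟨fun _ => B, integrable_const _, hc.mono fun y hy w hw => hB (w, c y) ⟨hw, hy⟩⟩

end ParametricIntegral

/-! ### Iterated operators and induction on multi-indices -/

section IterOp

/-- The common tool for carrying a property or a correspondence from the single operators to all
their iterates: smoothness of fields, locality, exchange with integrals. -/
theorem iterOp_rel {p : ℕ} {A B : Type} {T : Fin p → A → A} {S : Fin p → B → B}
    {R : A → B → Prop} (h : ∀ i a b, R a b → R (T i a) (S i b)) (J : Fin p → ℕ) {a : A} {b : B}
    (hab : R a b) : R (iterOp T J a) (iterOp S J b) := by
  unfold iterOp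
  induction List.finRange p with
  | nil => exact hab
  | cons i l ih =>
    simp only [List.foldr_cons, Function.comp_apply]
    generalize J i = n
    induction n with
    | zero => exact ih
    | succ n ihn =>
      rw [Function.iterate_succ_apply', Function.iterate_succ_apply']
      exact h i _ _ ihn

theorem prod_map_pow_add_single {ι M : Type*} [DecidableEq ι] [Monoid M] {x : ι → M}
    (hx : ∀ i j, Commute (x i) (x j)) (J : ι → ℕ) (i : ι) {l : List ι} (hl : l.Nodup) :
    (l.map fun j => x j ^ (J + Pi.single i 1 : ι → ℕ) j).prod
      = (if i ∈ l then x i else 1) * (l.map fun j => x j ^ J j).prod := by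
  induction l with
  | nil => simp
  | cons j l ih =>
    obtain ⟨hj, hl⟩ := List.nodup_cons.1 hl
    simp only [List.map_cons, List.prod_cons, ih hl]
    by_cases hij : i = j
    · subst hij
      simp [hj, pow_succ', mul_assoc]
    · have h1 : (Pi.single i 1 : ι → ℕ) j = 0 := Pi.single_eq_of_ne (Ne.symm hij) _
      simp only [Pi.add_apply, h1, add_zero, List.mem_cons, hij, false_or, ← mul_assoc]
      congr 1
      split_ifs
      · exact ((hx j i).pow_left _).eq
      · simp

theorem multiIndex_induction {p : ℕ} {P : (Fin p → ℕ) → Prop} (h0 : P 0)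
    (h1 : ∀ J i, P J → P (J + Pi.single i 1)) (J : Fin p → ℕ) : P J := by
  induction hn : ∑ i, J i generalizing J with
  | zero =>
    have : J = 0 := by
      funext i
      exact Finset.sum_eq_zero_iff.1 hn i (Finset.mem_univ i)
    exact this ▸ h0
  | succ n ih =>
    obtain ⟨i, hi⟩ : ∃ i, J i ≠ 0 := by
      by_contra! h
      simp [h] at hn
    have hle : Pi.single i 1 ≤ J := by
      intro j
      by_cases hij : j = i
      · subst hij
        simpa using Nat.one_le_iff_ne_zero.2 hi
      · simp [hij]
    have hJ : J = (J - Pi.single i 1) + Pi.single i 1 := (tsub_add_cancel_of_le hle).symm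
    rw [hJ]
    refine h1 _ i (ih _ ?_)
    rw [hJ] at hn
    simp only [Pi.add_apply, Finset.sum_add_distrib, Finset.sum_pi_single', Finset.mem_univ,
      if_true] at hn
    exact Nat.succ_injective hn

end IterOp

/-! ### Calculus of local functions on jets -/

variable {p q : ℕ}

theorem sum_add_single (J : Fin p → ℕ) (i : Fin p) :
    ∑ j, (J + Pi.single i 1 : Fin p → ℕ) j = ∑ j, J j + 1 := by
  simp [Finset.sum_add_distrib]

/-- The projection from jets of order at most `l` to jets of order at most `k ≤ l`. -/
def restr {k l : ℕ} (h : k ≤ l) : FinJet p q l →L[ℝ] FinJet p q k where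
  toFun w := (w.1, fun J => w.2 ⟨J.1, J.2.trans h⟩)
  map_add' _ _ := rfl
  map_smul' _ _ := rfl
  cont := by fun_prop

/-- Smooth functions of finitely many jet coordinates. -/
def IsLocal (F : Jet p q → ℝ) : Prop :=
  ∃ (k : ℕ) (f : FinJet p q k → ℝ), ContDiff ℝ ∞ f ∧ F = fun z => f (trunc k z)

theorem IsLocal.exists_order {F : Jet p q → ℝ} (hF : IsLocal F) :
    ∃ k, ∀ l, k ≤ l → ∃ f : FinJet p q l → ℝ, ContDiff ℝ ∞ f ∧ F = fun z => f (trunc l z) := by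
  obtain ⟨k, f, hf, rfl⟩ := hF
  exact ⟨k, fun l h => ⟨fun w => f (restr h w), hf.comp (restr h).contDiff, rfl⟩⟩

theorem IsLocal.exists_common {F G : Jet p q → ℝ} (hF : IsLocal F) (hG : IsLocal G) :
    ∃ (k : ℕ) (f g : FinJet p q k → ℝ), ContDiff ℝ ∞ f ∧ ContDiff ℝ ∞ g ∧
      F = (fun z => f (trunc k z)) ∧ G = fun z => g (trunc k z) := by
  obtain ⟨k, hk⟩ := hF.exists_order
  obtain ⟨l, hl⟩ := hG.exists_order
  obtain ⟨f, hf, hF⟩ := hk _ (le_max_left k l)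
  obtain ⟨g, hg, hG⟩ := hl _ (le_max_right k l)
  exact ⟨_, f, g, hf, hg, hF, hG⟩

theorem IsLocal.add {F G : Jet p q → ℝ} (hF : IsLocal F) (hG : IsLocal G) : IsLocal (F + G) := by
  obtain ⟨k, f, g, hf, hg, rfl, rfl⟩ := hF.exists_common hG
  exact ⟨k, _, hf.add hg, rfl⟩

theorem IsLocal.mul {F G : Jet p q → ℝ} (hF : IsLocal F) (hG : IsLocal G) : IsLocal (F * G) := by
  obtain ⟨k, f, g, hf, hg, rfl, rfl⟩ := hF.exists_common hG
  exact ⟨k, _, hf.mul hg, rfl⟩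

theorem isLocal_const (a : ℝ) : IsLocal (fun _ : Jet p q => a) :=
  ⟨0, fun _ => a, contDiff_const, rfl⟩

theorem isLocal_coord (J : Fin p → ℕ) (α : Fin q) : IsLocal (fun z : Jet p q => z.2 J α) :=
  ⟨∑ i, J i, fun w => w.2 ⟨J, le_rfl⟩ α, by fun_prop, rfl⟩

theorem isLocal_base (i : Fin p) : IsLocal (fun z : Jet p q => z.1 i) :=
  ⟨0, fun w => w.1 i, by fun_prop, rfl⟩

/-- The direction of the total derivative `D_i` at a jet. -/
def dirX (i : Fin p) (z : Jet p q) : Jet p q :=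
  (Pi.single i 1, fun J => z.2 (J + Pi.single i 1))

/-- Infinite jets carry no norm, but truncation is linear, so line derivatives of local functions
are Fréchet derivatives on a finite jet space. -/
theorem lineDeriv_comp_trunc {k : ℕ} {f : FinJet p q k → ℝ} (hf : Differentiable ℝ f)
    (z v : Jet p q) : lineDeriv ℝ (fun z => f (trunc k z)) z v
      = fderiv ℝ f (trunc k z) (trunc k v) :=
  (hf (trunc k z)).lineDeriv_eq_fderiv (v := trunc k v)

theorem IsLocal.lineDifferentiableAt {F : Jet p q → ℝ} (hF : IsLocal F) (z v : Jet p q) :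
    LineDifferentiableAt ℝ F z v := by
  obtain ⟨k, f, hf, rfl⟩ := hF
  exact ((hf.differentiable (by simp)) (trunc k z)).lineDifferentiableAt (v := trunc k v)

theorem IsLocal.lineDeriv_add_right {F : Jet p q → ℝ} (hF : IsLocal F) (z v w : Jet p q) :
    lineDeriv ℝ F z (v + w) = lineDeriv ℝ F z v + lineDeriv ℝ F z w := by
  obtain ⟨k, f, hf, rfl⟩ := hF
  simp only [lineDeriv_comp_trunc (hf.differentiable (by simp))]
  exact map_add _ (trunc k v) (trunc k w)

theorem derivU_comp_trunc_of_lt {k : ℕ} {f : FinJet p q k → ℝ} (hf : Differentiable ℝ f)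
    {J : Fin p → ℕ} (hJ : k < ∑ i, J i) (α : Fin q) : derivU J α (fun z => f (trunc k z)) = 0 := by
  funext z
  have h0 : trunc k ((0, Pi.single J (Pi.single α 1)) : Jet p q) = 0 := by
    refine Prod.ext rfl (funext fun K => ?_)
    have : K.1 ≠ J := fun h => by
      have := K.2
      rw [h] at this
      omega
    simp [trunc, this]
  rw [derivU, lineDeriv_comp_trunc hf, h0]
  simp

theorem finite_multiIndex (k : ℕ) : {J : Fin p → ℕ | ∑ i, J i ≤ k}.Finite :=
  Set.finite_coe_iff.1 (inferInstanceAs (Finite (MultiIndex p k)))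

theorem IsLocal.finite_derivU {F : Jet p q → ℝ} (hF : IsLocal F) (α : Fin q) :
    {J | derivU J α F ≠ 0}.Finite := by
  obtain ⟨k, f, hf, rfl⟩ := hF
  refine (finite_multiIndex k).subset fun J hJ => ?_
  by_contra h
  exact hJ (derivU_comp_trunc_of_lt (hf.differentiable (by simp)) (not_le.1 h) α)

theorem finsum_multiIndex {k : ℕ} {a : (Fin p → ℕ) → ℝ} (ha : ∀ J, k < ∑ i, J i → a J = 0) :
    ∑ᶠ J, a J = ∑ J : MultiIndex p k, a J.1 := by
  have h : Function.support a ⊆ Set.range (Subtype.val : MultiIndex p k → Fin p → ℕ) := by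
    intro J hJ
    refine ⟨⟨J, ?_⟩, rfl⟩
    by_contra h
    exact hJ (ha J (not_le.1 h))
  rw [← finsum_mem_univ, ← finsum_mem_inter_support, Set.univ_inter,
    ← Set.inter_eq_self_of_subset_right h, finsum_mem_inter_support,
    finsum_mem_range Subtype.val_injective, finsum_eq_sum_of_fintype]

theorem IsLocal.lineDeriv_vertical {F : Jet p q → ℝ} (hF : IsLocal F) (z : Jet p q)
    (w : (Fin p → ℕ) → Fin q → ℝ) :
    lineDeriv ℝ F z (0, w) = ∑ α, ∑ᶠ J, w J α * derivU J α F z := by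
  obtain ⟨k, f, hf, rfl⟩ := hF
  have hd := hf.differentiable (by simp)
  have h1 : ∀ α, ∑ᶠ J, w J α * derivU J α (fun z => f (trunc k z)) z
      = ∑ J : MultiIndex p k, w J.1 α * derivU J.1 α (fun z => f (trunc k z)) z := fun α =>
    finsum_multiIndex fun J hJ => by rw [derivU_comp_trunc_of_lt hd hJ]; simp
  have h2 : trunc k ((0, w) : Jet p q) = ∑ α, ∑ J : MultiIndex p k,
      w J.1 α • trunc k ((0, Pi.single J.1 (Pi.single α 1)) : Jet p q) := by
    refine Prod.ext ?_ (funext fun K => funext fun β => ?_)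
    · simp [trunc, Prod.fst_sum]
    · simp only [trunc, Prod.snd_sum, Finset.sum_apply, Prod.smul_snd, Pi.smul_apply, smul_eq_mul]
      rw [Finset.sum_eq_single β, Finset.sum_eq_single K]
      · simp
      · intro J _ hJ
        rw [Pi.single_eq_of_ne (fun h => hJ (Subtype.ext h.symm))]
        simp
      · simp
      · intro α _ hα
        refine Finset.sum_eq_zero fun J _ => ?_
        by_cases h : K.1 = J.1
        · rw [h]
          simp [Pi.single_eq_of_ne (Ne.symm hα)]
        · simp [Pi.single_eq_of_ne h]
      · simp
  rw [lineDeriv_comp_trunc hd, h2]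
  simp only [h1]
  simp only [derivU, lineDeriv_comp_trunc hd, map_sum, map_smul, smul_eq_mul]

/-- This reads `D_i` as one directional derivative along a point-dependent direction, which reduces
the commutation rules below to second derivatives. -/
theorem IsLocal.totalDeriv_apply {F : Jet p q → ℝ} (hF : IsLocal F) (i : Fin p) (z : Jet p q) :
    totalDeriv i F z = lineDeriv ℝ F z (dirX i z) := by
  have : dirX i z = (Pi.single i 1, 0) + (0, fun J => z.2 (J + Pi.single i 1)) := by
    simp [dirX]
  rw [this, hF.lineDeriv_add_right, hF.lineDeriv_vertical]
  rfl

theorem totalDeriv_comp_trunc {k : ℕ} {f : FinJet p q k → ℝ} (hf : ContDiff ℝ ∞ f) (i : Fin p) :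
    totalDeriv i (fun z => f (trunc k z))
      = fun z => fderiv ℝ f (trunc k z) (trunc k (dirX i z)) := by
  funext z
  rw [IsLocal.totalDeriv_apply ⟨k, f, hf, rfl⟩,
    lineDeriv_comp_trunc (hf.differentiable (by simp))]

theorem derivU_comp_trunc {k : ℕ} {f : FinJet p q k → ℝ} (hf : ContDiff ℝ ∞ f) (J : Fin p → ℕ)
    (α : Fin q) : derivU J α (fun z => f (trunc k z))
      = fun z => fderiv ℝ f (trunc k z) (trunc k (0, Pi.single J (Pi.single α 1))) := by
  funext z
  rw [derivU, lineDeriv_comp_trunc (hf.differentiable (by simp))]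

/-- The direction of the total derivative `D_i`, as a vector field on jets of finite order. -/
def finDirX (k : ℕ) (i : Fin p) (w : FinJet p q (k + 1)) : FinJet p q k :=
  (Pi.single i 1, fun J => w.2 ⟨J.1 + Pi.single i 1,
    (sum_add_single J.1 i).trans_le (Nat.succ_le_succ J.2)⟩)

theorem contDiff_finDirX (k : ℕ) (i : Fin p) : ContDiff ℝ ∞ (finDirX (q := q) k i) := by
  unfold finDirX
  fun_prop

theorem IsLocal.totalDeriv {F : Jet p q → ℝ} (hF : IsLocal F) (i : Fin p) :
    IsLocal (totalDeriv i F) := by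
  obtain ⟨k, f, hf, rfl⟩ := hF
  rw [totalDeriv_comp_trunc hf]
  exact ⟨k + 1, fun w => fderiv ℝ f (restr k.le_succ w) (finDirX k i w),
    ((hf.fderiv_right (m := ∞) (by simp)).comp (restr k.le_succ).contDiff).clm_apply
      (contDiff_finDirX k i), rfl⟩

theorem IsLocal.derivU {F : Jet p q → ℝ} (hF : IsLocal F) (J : Fin p → ℕ) (α : Fin q) :
    IsLocal (derivU J α F) := by
  obtain ⟨k, f, hf, rfl⟩ := hF
  rw [derivU_comp_trunc hf]
  exact ⟨k, fun w => fderiv ℝ f w (trunc k (0, Pi.single J (Pi.single α 1))),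
    (hf.fderiv_right (m := ∞) (by simp)).clm_apply contDiff_const, rfl⟩

/-- Product rule for a vector field `X` that is affine along `v`; constant coordinate directions and
`dirX` are both of this kind. -/
theorem lineDeriv_fderiv_comp_trunc {k : ℕ} {f : FinJet p q k → ℝ} (hf : ContDiff ℝ ∞ f)
    {X : Jet p q → Jet p q} {z v X' : Jet p q} (hX : ∀ t : ℝ, X (z + t • v) = X z + t • X') :
    lineDeriv ℝ (fun z => fderiv ℝ f (trunc k z) (trunc k (X z))) z v
      = fderiv ℝ (fderiv ℝ f) (trunc k z) (trunc k v) (trunc k (X z))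
        + fderiv ℝ f (trunc k z) (trunc k X') := by
  have hd : Differentiable ℝ (fderiv ℝ f) :=
    (hf.fderiv_right (m := ∞) (by simp)).differentiable (by simp)
  have h1 : HasDerivAt (fun t : ℝ => fderiv ℝ f (trunc k z + t • trunc k v))
      (fderiv ℝ (fderiv ℝ f) (trunc k z) (trunc k v)) 0 :=
    (hd (trunc k z)).hasFDerivAt.hasLineDerivAt (trunc k v)
  have h2 : HasDerivAt (fun t : ℝ => trunc k (X z) + t • trunc k X') (trunc k X') 0 := by
    simpa using ((hasDerivAt_id (0 : ℝ)).smul_const (trunc k X')).const_add (trunc k (X z))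
  have h3 := (h1.clm_apply h2).deriv
  simp only [zero_smul, add_zero] at h3
  rw [← h3, lineDeriv]
  simp only [hX]
  rfl

theorem fderiv_fderiv_comm {k : ℕ} {f : FinJet p q k → ℝ} (hf : ContDiff ℝ ∞ f)
    (w a b : FinJet p q k) : fderiv ℝ (fderiv ℝ f) w a b = fderiv ℝ (fderiv ℝ f) w b a :=
  (hf.contDiffAt.isSymmSndFDerivAt (by
    rw [minSmoothness_of_isRCLikeNormedField]; exact WithTop.coe_le_coe.2 (le_top : (2 : ℕ∞) ≤ ⊤))) a b

theorem dirX_add_smul (i : Fin p) (z v : Jet p q) (t : ℝ) :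
    dirX i (z + t • v) = dirX i z + t • (0, fun J => v.2 (J + Pi.single i 1)) := by
  refine Prod.ext ?_ rfl
  simp [dirX]

/-- The second-order terms agree by symmetry of the second derivative, and the first-order terms
because both shift the multi-index by e_i + e_j. -/
theorem IsLocal.totalDeriv_comm {F : Jet p q → ℝ} (hF : IsLocal F) (i j : Fin p) :
    NonlocalLagrangian.totalDeriv i (NonlocalLagrangian.totalDeriv j F)
      = NonlocalLagrangian.totalDeriv j (NonlocalLagrangian.totalDeriv i F) := by
  funext z
  rw [(hF.totalDeriv j).totalDeriv_apply, (hF.totalDeriv i).totalDeriv_apply]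
  obtain ⟨k, f, hf, rfl⟩ := hF
  rw [totalDeriv_comp_trunc hf, totalDeriv_comp_trunc hf,
    lineDeriv_fderiv_comp_trunc hf (dirX_add_smul j z _),
    lineDeriv_fderiv_comp_trunc hf (dirX_add_smul i z _), fderiv_fderiv_comm hf]
  simp only [dirX, add_right_comm]

/-- The commutator arises because the direction of `D_i` itself contains u_J, as the coefficient of
∂/∂u_{J-e_i}. If J has no i-th entry, no such coefficient exists; truncated subtraction makes the
case distinction necessary. -/
theorem IsLocal.derivU_totalDeriv {F : Jet p q → ℝ} (hF : IsLocal F) (i : Fin p)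
    (J : Fin p → ℕ) (α : Fin q) :
    NonlocalLagrangian.derivU J α (NonlocalLagrangian.totalDeriv i F)
      = NonlocalLagrangian.totalDeriv i (NonlocalLagrangian.derivU J α F)
        + if J i = 0 then 0 else NonlocalLagrangian.derivU (J - Pi.single i 1) α F := by
  funext z
  rw [Pi.add_apply, (hF.derivU J α).totalDeriv_apply]
  obtain ⟨k, f, hf, rfl⟩ := hF
  rw [totalDeriv_comp_trunc hf, derivU_comp_trunc hf, derivU_comp_trunc hf]
  rw [NonlocalLagrangian.derivU, lineDeriv_fderiv_comp_trunc hf (dirX_add_smul i z _),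
    lineDeriv_fderiv_comp_trunc hf (X := fun _ => (0, Pi.single J (Pi.single α 1))) (X' := 0)
      (by simp), fderiv_fderiv_comm hf]
  have h0 : trunc k (0 : Jet p q) = 0 := rfl
  rw [h0, map_zero, add_zero]
  congr 1
  split_ifs with hJ
  · have : (fun K : Fin p → ℕ => (Pi.single J (Pi.single α 1) : (Fin p → ℕ) → Fin q → ℝ)
        (K + Pi.single i 1)) = 0 := by
      funext K
      refine Pi.single_eq_of_ne (i := J) (fun h => ?_) _
      have := congrFun h i
      simp [hJ] at this
    dsimp only
    rw [this, ← Prod.zero_eq_mk, h0, map_zero]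
    rfl
  · congr 2
    refine Prod.ext rfl (funext fun K => ?_)
    have hle : Pi.single i 1 ≤ J := by
      intro j
      by_cases hij : j = i
      · subst hij
        simpa using Nat.one_le_iff_ne_zero.2 hJ
      · simp [hij]
    dsimp only
    by_cases hK : K = J - Pi.single i 1
    · rw [hK, tsub_add_cancel_of_le hle, Pi.single_eq_same, Pi.single_eq_same]
    · rw [Pi.single_eq_of_ne hK, Pi.single_eq_of_ne fun h => hK (eq_tsub_of_add_eq h)]

theorem IsLocal.totalDeriv_mul {F G : Jet p q → ℝ} (hF : IsLocal F) (hG : IsLocal G)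
    (i : Fin p) : NonlocalLagrangian.totalDeriv i (F * G)
      = NonlocalLagrangian.totalDeriv i F * G + F * NonlocalLagrangian.totalDeriv i G := by
  funext z
  rw [(hF.mul hG).totalDeriv_apply, Pi.add_apply, Pi.mul_apply, Pi.mul_apply,
    hF.totalDeriv_apply, hG.totalDeriv_apply]
  have h := deriv_mul (hF.lineDifferentiableAt z (dirX i z)) (hG.lineDifferentiableAt z (dirX i z))
  simp only [zero_smul, add_zero] at h
  exact h

theorem IsLocal.lineDeriv_add {F G : Jet p q → ℝ} (hF : IsLocal F) (hG : IsLocal G)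
    (z v : Jet p q) : lineDeriv ℝ (F + G) z v = lineDeriv ℝ F z v + lineDeriv ℝ G z v :=
  deriv_add (hF.lineDifferentiableAt z v) (hG.lineDifferentiableAt z v)

theorem lineDeriv_const_smul' (a : ℝ) (F : Jet p q → ℝ) (z v : Jet p q) :
    lineDeriv ℝ (a • F) z v = a • lineDeriv ℝ F z v := by
  simp only [lineDeriv]
  exact deriv_fun_const_smul_field a _

/-! ### The Euler operator on the algebra of local functions -/

/-- The algebra of smooth functions of finitely many jet coordinates. -/
def LocalFun (p q : ℕ) : Subalgebra ℝ (Jet p q → ℝ) where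
  carrier := {F | IsLocal F}
  mul_mem' := IsLocal.mul
  add_mem' := IsLocal.add
  algebraMap_mem' a := isLocal_const a

/-- The total derivative as a linear endomorphism. -/
def totalD (i : Fin p) : Module.End ℝ (LocalFun p q) where
  toFun F := ⟨totalDeriv i F, F.2.totalDeriv i⟩
  map_add' F G := by
    ext z
    change totalDeriv i ((F : Jet p q → ℝ) + (G : Jet p q → ℝ)) z = totalDeriv i F z + totalDeriv i G z
    rw [(F.2.add G.2).totalDeriv_apply, F.2.totalDeriv_apply, G.2.totalDeriv_apply,
      F.2.lineDeriv_add G.2]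
  map_smul' a F := by
    ext z
    change totalDeriv i (a • (F : Jet p q → ℝ)) z = a • totalDeriv i F z
    rw [IsLocal.totalDeriv_apply (F := a • (F : Jet p q → ℝ)) (a • F).2, F.2.totalDeriv_apply, lineDeriv_const_smul']

/-- The coordinate derivative `∂/∂u_J^α` as a linear endomorphism. -/
def coordD (J : Fin p → ℕ) (α : Fin q) : Module.End ℝ (LocalFun p q) where
  toFun F := ⟨derivU J α F, F.2.derivU J α⟩
  map_add' F G := by
    ext z
    exact F.2.lineDeriv_add G.2 _ _
  map_smul' a F := by
    ext z
    exact lineDeriv_const_smul' _ _ _ _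

/-- The iterated total derivative `D_J` as a linear endomorphism. -/
def iterD (J : Fin p → ℕ) : Module.End ℝ (LocalFun p q) :=
  ((List.finRange p).map fun i => totalD i ^ J i).prod

theorem coe_iterD (J : Fin p → ℕ) (F : LocalFun p q) :
    (iterD J F : Jet p q → ℝ) = iterOp totalDeriv J F := by
  have h1 : iterD J F = iterOp (fun i => ⇑(totalD i)) J F := by
    unfold iterD iterOp
    induction List.finRange p with
    | nil => rfl
    | cons i l ih => simp [ih, Module.End.mul_apply, Module.End.coe_pow]
  rw [h1]
  exact iterOp_rel (R := fun (a : LocalFun p q) (b : Jet p q → ℝ) => (a : Jet p q → ℝ) = b)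
    (fun i a b h => by subst h; rfl) J rfl

theorem iterD_zero : iterD (0 : Fin p → ℕ) = (1 : Module.End ℝ (LocalFun p q)) := by
  simp [iterD]

theorem iterD_add_single (J : Fin p → ℕ) (i : Fin p) :
    iterD (J + Pi.single i 1) = totalD (q := q) i * iterD J := by
  have h := prod_map_pow_add_single (x := totalD (q := q)) (fun i j => LinearMap.ext fun F =>
      Subtype.ext (F.2.totalDeriv_comm i j)) J i (List.nodup_finRange p)
  rwa [if_pos (List.mem_finRange i)] at h

theorem totalD_mul_iterD (J : Fin p → ℕ) (i : Fin p) :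
    totalD (q := q) i * iterD J = iterD J * totalD i := by
  induction J using multiIndex_induction with
  | h0 => simp [iterD_zero]
  | h1 J j ih =>
    have hc : totalD (q := q) i * totalD j = totalD j * totalD i :=
      LinearMap.ext fun F => Subtype.ext (F.2.totalDeriv_comm i j)
    rw [iterD_add_single, ← mul_assoc, hc, mul_assoc, ih, mul_assoc]

theorem totalD_mul (i : Fin p) (F G : LocalFun p q) :
    totalD i (F * G) = totalD i F * G + F * totalD i G :=
  Subtype.ext (F.2.totalDeriv_mul G.2 i)

theorem coordD_totalD (i : Fin p) (J : Fin p → ℕ) (α : Fin q) (F : LocalFun p q) :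
    coordD J α (totalD i F)
      = totalD i (coordD J α F) + if J i = 0 then 0 else coordD (J - Pi.single i 1) α F := by
  refine Subtype.ext ((F.2.derivU_totalDeriv i J α).trans ?_)
  split_ifs <;> rfl

theorem finite_coordD (α : Fin q) (F : LocalFun p q) : {J | coordD J α F ≠ 0}.Finite := by
  refine (F.2.finite_derivU α).subset fun J hJ h => hJ (Subtype.ext h)

theorem finite_support_iterD (α : Fin q) (F : LocalFun p q)
    (T : (Fin p → ℕ) → Module.End ℝ (LocalFun p q)) (z : Jet p q) :
    (Function.support fun J => (-1) ^ (∑ i, J i) * (T J (coordD J α F) : Jet p q → ℝ) z).Finite := by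
  refine (finite_coordD α F).subset fun J hJ h => hJ ?_
  simp [h]

theorem euler_coe (α : Fin q) (F : LocalFun p q) (z : Jet p q) :
    euler α F z
      = ∑ᶠ J : Fin p → ℕ, (-1) ^ (∑ i, J i) * (iterD J (coordD J α F) : Jet p q → ℝ) z := by
  simp only [coe_iterD]
  rfl

/-- By the commutator rule the J-th term is T_J - T_{J-e_i}, where T_J = (-1)^{|J|} D_{J+e_i}
∂F/∂u_J. The two finite sums differ by a shift of the index and cancel. -/
theorem euler_totalD (α : Fin q) (i : Fin p) (F : LocalFun p q) (z : Jet p q) :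
    euler α (totalD i F : LocalFun p q) z = 0 := by
  set T : (Fin p → ℕ) → ℝ := fun J =>
    (-1) ^ (∑ j, J j) * (iterD (J + Pi.single i 1) (coordD J α F) : Jet p q → ℝ) z with hT
  set S : (Fin p → ℕ) → ℝ := fun J => if J i = 0 then 0 else T (J - Pi.single i 1) with hS
  have hTfin : (Function.support T).Finite :=
    finite_support_iterD α F (fun J => iterD (J + Pi.single i 1)) z
  have hinj : Function.Injective fun J : Fin p → ℕ => J + Pi.single i 1 :=
    add_left_injective _
  have hSadd : ∀ J, S (J + Pi.single i 1) = T J := by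
    intro J
    simp [hS]
  have hsub : ∀ J : Fin p → ℕ, J i ≠ 0 → J - Pi.single i 1 + Pi.single i 1 = J := by
    intro J hJ
    refine tsub_add_cancel_of_le fun j => ?_
    by_cases hij : j = i
    · subst hij
      simpa using Nat.one_le_iff_ne_zero.2 hJ
    · simp [hij]
  have hsupp : Function.support S ⊆ Set.range fun J : Fin p → ℕ => J + Pi.single i 1 := by
    intro J hJ
    refine ⟨J - Pi.single i 1, hsub J fun h => hJ ?_⟩
    simp [hS, h]
  have hsum : ∑ᶠ J, S J = ∑ᶠ J, T J := by
    rw [← finsum_mem_univ, ← finsum_mem_inter_support, Set.univ_inter,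
      ← Set.inter_eq_self_of_subset_right hsupp, finsum_mem_inter_support,
      finsum_mem_range hinj]
    simp only [hSadd]
  have hSfin : (Function.support S).Finite := by
    refine (hTfin.image fun J => J + Pi.single i 1).subset fun J hJ => ?_
    obtain ⟨K, rfl⟩ := hsupp hJ
    refine ⟨K, ?_, rfl⟩
    rwa [Function.mem_support, ← hSadd K]
  have hterm : ∀ J : Fin p → ℕ, (-1) ^ (∑ j, J j)
      * (iterD J (coordD J α (totalD i F)) : Jet p q → ℝ) z = T J - S J := by
    intro J
    have h1 : iterD J (totalD i (coordD J α F)) = iterD (J + Pi.single i 1) (coordD J α F) := by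
      rw [iterD_add_single, totalD_mul_iterD]
      rfl
    rw [coordD_totalD, map_add, h1]
    by_cases hJ : J i = 0
    · simp [hS, hT, hJ]
    · obtain ⟨K, rfl⟩ : ∃ K : Fin p → ℕ, J = K + Pi.single i 1 := ⟨_, (hsub J hJ).symm⟩
      rw [if_neg hJ, hSadd, add_tsub_cancel_right]
      simp only [hT, sum_add_single, pow_succ]
      change _ * ((_ : ℝ) + _) = _
      ring
  rw [euler_coe]
  simp only [hterm]
  rw [finsum_sub_distrib hTfin hSfin, hsum, sub_self]

theorem euler_sum {ι : Type*} (s : Finset ι) (α : Fin q) (F : ι → LocalFun p q) (z : Jet p q) :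
    euler α ((∑ i ∈ s, F i : LocalFun p q) : Jet p q → ℝ) z = ∑ i ∈ s, euler α (F i) z := by
  rw [euler_coe]
  simp only [map_sum, AddSubmonoidClass.coe_finsetSum, Finset.sum_apply, Finset.mul_sum, euler_coe]
  exact finsum_sum_comm s _ fun i _ => finite_support_iterD α (F i) iterD z

/-- Total divergences of local functions lie in the kernel of the Euler operator. -/
theorem euler_totalDiv (α : Fin q) (P : Fin p → LocalFun p q) (z : Jet p q) :
    euler α (totalDiv fun i => P i) z = 0 := by
  have h : totalDiv (fun i => (P i : Jet p q → ℝ))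
      = ((∑ i, totalD i (P i) : LocalFun p q) : Jet p q → ℝ) := by
    ext z
    simp only [AddSubmonoidClass.coe_finsetSum, Finset.sum_apply]
    rfl
  rw [h, euler_sum]
  exact Finset.sum_eq_zero fun i _ => euler_totalD α i (P i) z

/-- The jet coordinate `u_J^α` as a local function. -/
def coord (J : Fin p → ℕ) (α : Fin q) : LocalFun p q :=
  ⟨fun z => z.2 J α, isLocal_coord J α⟩

theorem totalD_coord (i : Fin p) (J : Fin p → ℕ) (α : Fin q) :
    totalD i (coord J α) = coord (J + Pi.single i 1) α := by
  ext z
  refine ((isLocal_coord J α).totalDeriv_apply i z).trans ?_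
  have h : HasDerivAt (fun t : ℝ => z.2 J α + t * z.2 (J + Pi.single i 1) α)
      (z.2 (J + Pi.single i 1) α) 0 := by
    simpa using ((hasDerivAt_id (0 : ℝ)).mul_const (z.2 (J + Pi.single i 1) α)).const_add (z.2 J α)
  exact h.deriv

/-- Integration by parts: `u_J^α F` and `u^α (-D)_J F` differ by a total divergence. -/
theorem exists_coord_mul_eq (J : Fin p → ℕ) (α : Fin q) (F : LocalFun p q) :
    ∃ Q : Fin p → LocalFun p q, coord J α * F
      = (-1 : ℝ) ^ (∑ i, J i) • (coord 0 α * iterD J F) + ∑ i, totalD i (Q i) := by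
  induction J using multiIndex_induction generalizing F with
  | h0 => exact ⟨0, by simp [iterD_zero]⟩
  | h1 J i ih =>
    obtain ⟨Q, hQ⟩ := ih (totalD i F)
    -- From u_{J+e_i} F = D_i(u_J F) - u_J D_i F: the boundary term enters component i, and the
    -- remaining `Q` for D_i F changes sign.
    refine ⟨fun j => (if j = i then coord J α * F else 0) - Q j, ?_⟩
    have h1 : coord (J + Pi.single i 1) α * F
        = totalD i (coord J α * F) - coord J α * totalD i F := by
      rw [totalD_mul, totalD_coord, add_sub_cancel_right]
    have h2 : iterD (J + Pi.single i 1) F = iterD J (totalD i F) := by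
      rw [iterD_add_single, totalD_mul_iterD]
      rfl
    have h3 : ∑ j, totalD j (if j = i then coord J α * F else 0) = totalD i (coord J α * F) := by
      rw [Finset.sum_eq_single i (fun j _ hj => by rw [if_neg hj, map_zero]) (by simp), if_pos rfl]
    simp only [map_sub, Finset.sum_sub_distrib, h3]
    rw [h1, hQ, h2, sum_add_single, pow_succ, mul_neg_one, neg_smul]
    abel

/-! ### Locality in the base point and cutoffs -/

section Locality

variable {V : Set (Fin p → ℝ)}

theorem lineDeriv_congr_of_isOpen (hV : IsOpen V) {F G : Jet p q → ℝ}
    (h : ∀ z : Jet p q, z.1 ∈ V → F z = G z) {z : Jet p q} (hz : z.1 ∈ V) (v : Jet p q) :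
    lineDeriv ℝ F z v = lineDeriv ℝ G z v := by
  refine Filter.EventuallyEq.deriv_eq ?_
  have hc : Continuous fun t : ℝ => z.1 + t • v.1 := by fun_prop
  have h0 : ∀ᶠ t in nhds (0 : ℝ), z.1 + t • v.1 ∈ V :=
    hc.continuousAt.eventually_mem (hV.mem_nhds (by simpa using hz))
  exact h0.mono fun t ht => h _ ht

theorem totalDeriv_congr (hV : IsOpen V) {F G : Jet p q → ℝ}
    (h : ∀ z : Jet p q, z.1 ∈ V → F z = G z) (i : Fin p) {z : Jet p q} (hz : z.1 ∈ V) :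
    totalDeriv i F z = totalDeriv i G z := by
  simp only [totalDeriv, derivX, derivU, lineDeriv_congr_of_isOpen hV h hz]

/-- Each derivative involved sees only jets with nearby base points, so agreement over an open set
of the base persists through all iterates. -/
theorem euler_congr (hV : IsOpen V) {F G : Jet p q → ℝ}
    (h : ∀ z : Jet p q, z.1 ∈ V → F z = G z) (α : Fin q) {z : Jet p q} (hz : z.1 ∈ V) :
    euler α F z = euler α G z := by
  unfold euler
  congr! 3 with J
  refine iterOp_rel (R := fun F G : Jet p q → ℝ => ∀ z : Jet p q, z.1 ∈ V → F z = G z)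
    ?_ J ?_ z hz
  · intro i a b hab z hz
    exact totalDeriv_congr hV hab i hz
  · intro z hz
    exact lineDeriv_congr_of_isOpen hV h hz _

/-- Multiplying by a bump function of the base point alone extends `f` by zero beyond Ω without
changing it over the inner ball. -/
theorem exists_isLocal_eq_of_contDiffOn {Ω : Set (Fin p → ℝ)} (hΩ : IsOpen Ω) {k : ℕ}
    {f : FinJet p q k → ℝ} (hf : ContDiffOn ℝ ∞ f {w | w.1 ∈ Ω}) {x : Fin p → ℝ} (χ : ContDiffBump x)
    (hχ : Metric.closedBall x χ.rOut ⊆ Ω) :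
    ∃ F : LocalFun p q, ∀ z : Jet p q, z.1 ∈ Metric.ball x χ.rIn →
      (F : Jet p q → ℝ) z = f (trunc k z) := by
  refine ⟨⟨fun z => χ z.1 * f (trunc k z), k, fun w => χ w.1 * f w, ?_, rfl⟩, fun z hz => ?_⟩
  · rw [contDiff_iff_contDiffAt]
    intro w
    have hχw : ContDiff ℝ ∞ fun w : FinJet p q k => χ w.1 := χ.contDiff.comp contDiff_fst
    by_cases hw : w.1 ∈ Ω
    · exact hχw.contDiffAt.mul
        (hf.contDiffAt ((hΩ.preimage continuous_fst).mem_nhds hw))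
    · refine contDiffAt_const (c := (0 : ℝ)) |>.congr_of_eventuallyEq ?_
      have hU : IsOpen {w : FinJet p q k | w.1 ∈ (Metric.closedBall x χ.rOut)ᶜ} :=
        Metric.isClosed_closedBall.isOpen_compl.preimage continuous_fst
      filter_upwards [hU.mem_nhds fun h => hw (hχ h)] with v hv
      have : χ v.1 = 0 := by
        refine χ.zero_of_le_dist (le_of_not_ge fun h => hv h)
      simp [this]
  · change χ z.1 * _ = _
    rw [χ.one_of_mem_closedBall (Metric.ball_subset_closedBall hz), one_mul]

/-- The Euler operator annihilates total divergences over an open set. -/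
theorem IsTotalDivOver.euler_eq_zero {Ω : Set (Fin p → ℝ)} (hΩ : IsOpen Ω) {F : Jet p q → ℝ}
    (hF : IsTotalDivOver Ω F) (α : Fin q) {z : Jet p q} (hz : z.1 ∈ Ω) : euler α F z = 0 := by
  obtain ⟨k, P, hP, hFP⟩ := hF
  obtain ⟨ε, hε, hball⟩ := Metric.nhds_basis_closedBall.mem_iff.1 (hΩ.mem_nhds hz)
  let χ : ContDiffBump z.1 := ⟨ε / 2, ε, half_pos hε, half_lt_self hε⟩
  choose Q hQ using fun i => exists_isLocal_eq_of_contDiffOn hΩ (hP i) χ hball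
  have hsub : Metric.ball z.1 χ.rIn ⊆ Ω := fun x hx =>
    hball (Metric.ball_subset_closedBall (Metric.ball_subset_ball (half_lt_self hε).le hx))
  rw [euler_congr (V := Metric.ball z.1 χ.rIn) Metric.isOpen_ball
    (G := totalDiv fun i => Q i) (fun w hw => ?_) α (Metric.mem_ball_self χ.rIn_pos)]
  · exact euler_totalDiv α Q z
  · rw [hFP w (hsub hw)]
    exact Finset.sum_congr rfl fun i _ =>
      totalDeriv_congr Metric.isOpen_ball (fun v hv => (hQ i v hv).symm) i hw

end Locality

/-! ### Exchanging jet operators with parameter integrals -/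

section ParamLocal

variable {Y : Type*} [MeasurableSpace Y] {μ : Measure Y}
  {C : Type} [NormedAddCommGroup C] [NormedSpace ℝ C] {c : Y → C} {Φ : C → Jet p q → ℝ}

/-- Families of local functions, of uniform order and smooth in the parameter, that can be
integrated along `c` together with all their derivatives. -/
def IsParamLocal (μ : Measure Y) (c : Y → C) (Φ : C → Jet p q → ℝ) : Prop :=
  ∃ (k : ℕ) (g : FinJet p q k × C → ℝ), ContDiff ℝ ∞ g ∧
    Dominated μ (fun y z => g (z, c y)) ∧ Φ = fun a z => g (trunc k z, a)

theorem IsParamLocal.integrable (hc : AEStronglyMeasurable c μ) (hΦ : IsParamLocal μ c Φ)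
    (z : Jet p q) : Integrable (fun y => Φ (c y) z) μ := by
  obtain ⟨k, g, hg, hd, rfl⟩ := hΦ
  exact hd.integrable hg hc (trunc k z)

theorem IsParamLocal.isLocal_integral (hc : AEStronglyMeasurable c μ)
    (hΦ : IsParamLocal μ c Φ) : IsLocal (fun z => ∫ y, Φ (c y) z ∂μ) := by
  obtain ⟨k, g, hg, hd, rfl⟩ := hΦ
  exact ⟨k, _, hd.contDiff_integral hg hc, rfl⟩

theorem IsParamLocal.totalDeriv (hΦ : IsParamLocal μ c Φ) (i : Fin p) :
    IsParamLocal μ c (fun a => totalDeriv i (Φ a)) := by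
  obtain ⟨k, g, hg, hd, rfl⟩ := hΦ
  refine ⟨k + 1, sliceDeriv (restr k.le_succ) (finDirX k i) g,
    contDiff_sliceDeriv _ (contDiff_finDirX k i) hg,
    hd.sliceDeriv _ (contDiff_finDirX k i) hg, ?_⟩
  funext a z
  rw [totalDeriv_comp_trunc (contDiff_slice hg a)]
  rfl

theorem IsParamLocal.derivU (hΦ : IsParamLocal μ c Φ) (J : Fin p → ℕ) (α : Fin q) :
    IsParamLocal μ c (fun a => derivU J α (Φ a)) := by
  obtain ⟨k, g, hg, hd, rfl⟩ := hΦ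
  let v : FinJet p q k := trunc k (0, Pi.single J (Pi.single α 1))
  refine ⟨k, sliceDeriv (.id ℝ _) (fun _ => v) g, contDiff_sliceDeriv _ contDiff_const hg,
    hd.sliceDeriv _ contDiff_const hg, ?_⟩
  funext a z
  rw [derivU_comp_trunc (contDiff_slice hg a)]
  rfl

theorem IsParamLocal.totalDeriv_integral (hc : AEStronglyMeasurable c μ)
    (hΦ : IsParamLocal μ c Φ) (i : Fin p) :
    NonlocalLagrangian.totalDeriv i (fun z => ∫ y, Φ (c y) z ∂μ)
      = fun z => ∫ y, NonlocalLagrangian.totalDeriv i (Φ (c y)) z ∂μ := by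
  obtain ⟨k, g, hg, hd, rfl⟩ := hΦ
  funext z
  rw [totalDeriv_comp_trunc (hd.contDiff_integral hg hc)]
  simp only [totalDeriv_comp_trunc (contDiff_slice hg _)]
  exact hd.fderiv_integral_apply hg hc _ _

theorem IsParamLocal.derivU_integral (hc : AEStronglyMeasurable c μ)
    (hΦ : IsParamLocal μ c Φ) (J : Fin p → ℕ) (α : Fin q) :
    NonlocalLagrangian.derivU J α (fun z => ∫ y, Φ (c y) z ∂μ)
      = fun z => ∫ y, NonlocalLagrangian.derivU J α (Φ (c y)) z ∂μ := by
  obtain ⟨k, g, hg, hd, rfl⟩ := hΦ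
  funext z
  rw [derivU_comp_trunc (hd.contDiff_integral hg hc)]
  simp only [derivU_comp_trunc (contDiff_slice hg _)]
  exact hd.fderiv_integral_apply hg hc _ _

/-- The two claims are proved together, since exchanging the next `D_i` with the integral needs
integrability of the family already differentiated. -/
theorem IsParamLocal.iterOp_totalDeriv (hc : AEStronglyMeasurable c μ)
    (hΦ : IsParamLocal μ c Φ) (J : Fin p → ℕ) :
    IsParamLocal μ c (fun a => iterOp NonlocalLagrangian.totalDeriv J (Φ a)) ∧
      iterOp NonlocalLagrangian.totalDeriv J (fun z => ∫ y, Φ (c y) z ∂μ)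
        = fun z => ∫ y, iterOp NonlocalLagrangian.totalDeriv J (Φ (c y)) z ∂μ := by
  let T : Fin p → (C → Jet p q → ℝ) → C → Jet p q → ℝ :=
    fun i Φ a => NonlocalLagrangian.totalDeriv i (Φ a)
  have hT : iterOp T J Φ = fun a => iterOp NonlocalLagrangian.totalDeriv J (Φ a) := by
    funext a
    refine iterOp_rel (R := fun (Φ : C → Jet p q → ℝ) (F : Jet p q → ℝ) => Φ a = F) ?_ J rfl
    intro i Φ F h
    exact congrArg (NonlocalLagrangian.totalDeriv i) h
  have h := iterOp_rel (T := T) (S := NonlocalLagrangian.totalDeriv)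
    (R := fun (Φ : C → Jet p q → ℝ) (F : Jet p q → ℝ) =>
      IsParamLocal μ c Φ ∧ F = fun z => ∫ y, Φ (c y) z ∂μ)
    (by
      rintro i Φ F ⟨h, rfl⟩
      exact ⟨h.totalDeriv i, h.totalDeriv_integral hc i⟩) J (a := Φ) ⟨hΦ, rfl⟩
  rwa [hT] at h

theorem iterOp_totalDeriv_zero (J : Fin p → ℕ) :
    iterOp totalDeriv J (0 : Jet p q → ℝ) = 0 := by
  have h := coe_iterD J (0 : LocalFun p q)
  rw [map_zero] at h
  exact h.symm

/-- The Euler operator commutes with integration over a parameter. -/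
theorem IsParamLocal.euler_integral (hc : AEStronglyMeasurable c μ)
    (hΦ : IsParamLocal μ c Φ) (α : Fin q) (z : Jet p q) :
    euler α (fun z => ∫ y, Φ (c y) z ∂μ) z = ∫ y, euler α (Φ (c y)) z ∂μ := by
  -- The order bound is uniform in the parameter, so one finite sum serves for every integrand and
  -- can be exchanged with the integral.
  obtain ⟨k, hk⟩ : ∃ k, ∀ J : Fin p → ℕ, k < ∑ i, J i → ∀ a,
      NonlocalLagrangian.derivU J α (Φ a) = 0 := by
    obtain ⟨k, g, hg, hd, rfl⟩ := hΦ
    exact ⟨k, fun J hJ a => derivU_comp_trunc_of_lt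
      ((contDiff_slice hg a).differentiable (by simp)) hJ α⟩
  have hJ := fun J => (hΦ.derivU J α).iterOp_totalDeriv hc J
  unfold euler
  simp only [hΦ.derivU_integral hc, (hJ _).2]
  rw [finsum_multiIndex (k := k) fun J h => by simp [hk J h, iterOp_totalDeriv_zero]]
  have h2 : ∀ y, ∑ᶠ J : Fin p → ℕ, (-1) ^ (∑ i, J i)
      * iterOp NonlocalLagrangian.totalDeriv J (NonlocalLagrangian.derivU J α (Φ (c y))) z
      = ∑ J : MultiIndex p k, (-1) ^ (∑ i, J.1 i) * iterOp NonlocalLagrangian.totalDeriv J.1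
        (NonlocalLagrangian.derivU J.1 α (Φ (c y))) z := fun y =>
    finsum_multiIndex fun J h => by simp [hk J h, iterOp_totalDeriv_zero]
  simp only [h2]
  rw [integral_finsetSum _ fun J _ => ((hJ J.1).1.integrable hc z).const_mul _]
  simp only [integral_const_mul]

end ParamLocal

/-! ### The scaling homotopy and the kernel of the Euler operator -/

section Homotopy

/-- The scaling of the field coordinates by `t`. -/
def scale (t : ℝ) (z : Jet p q) : Jet p q := (z.1, t • z.2)

theorem lineDeriv_comp_scale (F : Jet p q → ℝ) (t : ℝ) (z v : Jet p q) :
    lineDeriv ℝ (fun z => F (scale t z)) z v = lineDeriv ℝ F (scale t z) (scale t v) := by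
  have : ∀ s : ℝ, scale t (z + s • v) = scale t z + s • scale t v := fun s =>
    Prod.ext rfl (by simp [scale, smul_comm s t])
  simp only [lineDeriv, this]

theorem contDiff_comp_scale {k : ℕ} {f : FinJet p q k → ℝ} (hf : ContDiff ℝ ∞ f) :
    ContDiff ℝ ∞ fun w : FinJet p q k × ℝ => f (w.1.1, w.2 • w.1.2) :=
  hf.comp (by fun_prop)

theorem IsLocal.comp_scale {F : Jet p q → ℝ} (hF : IsLocal F) (t : ℝ) :
    IsLocal fun z => F (scale t z) := by
  obtain ⟨k, f, hf, rfl⟩ := hF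
  exact ⟨k, _, contDiff_slice (contDiff_comp_scale hf) t, rfl⟩

theorem IsLocal.totalDeriv_comp_scale {F : Jet p q → ℝ} (hF : IsLocal F) (i : Fin p) (t : ℝ)
    (z : Jet p q) : NonlocalLagrangian.totalDeriv i (fun z => F (scale t z)) z
      = NonlocalLagrangian.totalDeriv i F (scale t z) := by
  rw [(hF.comp_scale t).totalDeriv_apply, hF.totalDeriv_apply, lineDeriv_comp_scale]
  rfl

theorem isParamLocal_unit_interval {k : ℕ} {g : FinJet p q k × ℝ → ℝ} (hg : ContDiff ℝ ∞ g) :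
    IsParamLocal (volume.restrict (Set.Ioc (0 : ℝ) 1)) (fun t => t)
      (fun t (z : Jet p q) => g (trunc k z, t)) :=
  ⟨k, g, hg, dominated_of_isCompact hg (isCompact_Icc (a := (0 : ℝ)) (b := 1))
    (ae_restrict_of_forall_mem measurableSet_Ioc fun _ ht => Set.Ioc_subset_Icc_self ht), rfl⟩

theorem IsLocal.isParamLocal_scale {F : Jet p q → ℝ} (hF : IsLocal F) :
    IsParamLocal (volume.restrict (Set.Ioc (0 : ℝ) 1)) (fun t => t)
      (fun t (z : Jet p q) => F (scale t z)) := by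
  obtain ⟨k, f, hf, rfl⟩ := hF
  exact isParamLocal_unit_interval (contDiff_comp_scale hf)

/-- The average of a local function over the scalings of the field coordinates. -/
def scaleMean (F : LocalFun p q) : LocalFun p q :=
  ⟨fun z => ∫ t in Set.Ioc (0 : ℝ) 1, (F : Jet p q → ℝ) (scale t z),
    F.2.isParamLocal_scale.isLocal_integral (c := fun t : ℝ => t) aestronglyMeasurable_id⟩

theorem integrable_comp_scale (F : LocalFun p q) (z : Jet p q) :
    IntegrableOn (fun t : ℝ => (F : Jet p q → ℝ) (scale t z)) (Set.Ioc 0 1) :=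
  F.2.isParamLocal_scale.integrable (c := fun t : ℝ => t) aestronglyMeasurable_id z

theorem totalD_scaleMean (i : Fin p) (F : LocalFun p q) :
    totalD i (scaleMean F) = scaleMean (totalD i F) := by
  refine Subtype.ext ((F.2.isParamLocal_scale.totalDeriv_integral (c := fun t : ℝ => t)
    aestronglyMeasurable_id i).trans ?_)
  simp only [F.2.totalDeriv_comp_scale]
  rfl

theorem iterD_scaleMean (J : Fin p → ℕ) (F : LocalFun p q) :
    iterD J (scaleMean F) = scaleMean (iterD J F) := by
  induction J using multiIndex_induction with
  | h0 => simp [iterD_zero]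
  | h1 J i ih => simp [iterD_add_single, Module.End.mul_apply, ih, totalD_scaleMean]

theorem LocalFun.exists_finset (F : LocalFun p q) :
    ∃ S : Finset (Fin p → ℕ), ∀ J ∉ S, ∀ α, coordD J α F = 0 := by
  refine ⟨Finset.univ.biUnion fun α => (finite_coordD α F).toFinset, fun J hJ α => ?_⟩
  by_contra h
  exact hJ (by simpa using ⟨α, h⟩)

/-- The fundamental theorem of calculus along the ray from (x,0) to (x,u), whose velocity is the
vertical vector u. -/
theorem sub_comp_scale_zero (F : LocalFun p q) {S : Finset (Fin p → ℕ)}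
    (hS : ∀ J ∉ S, ∀ α, coordD J α F = 0) (z : Jet p q) :
    (F : Jet p q → ℝ) z - (F : Jet p q → ℝ) (scale 0 z)
      = ∑ α, ∑ J ∈ S, z.2 J α * (scaleMean (coordD J α F) : Jet p q → ℝ) z := by
  have hvert : ∀ t, lineDeriv ℝ F (scale t z) (0, z.2)
      = ∑ α, ∑ J ∈ S, z.2 J α * (coordD J α F : Jet p q → ℝ) (scale t z) := fun t => by
    rw [F.2.lineDeriv_vertical]
    refine Finset.sum_congr rfl fun α _ => finsum_eq_sum_of_support_subset _ fun J hJ => ?_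
    by_contra h
    refine hJ ?_
    have h0 : derivU J α F = 0 := congrArg Subtype.val (hS J h α)
    simp [h0]
  have hderiv : ∀ t : ℝ, HasDerivAt (fun t => (F : Jet p q → ℝ) (scale t z))
      (lineDeriv ℝ F (scale t z) (0, z.2)) t := fun t => by
    have h := (F.2.lineDifferentiableAt (scale t z) (0, z.2)).hasLineDerivAt
    have h1 : HasDerivAt (fun s : ℝ => (F : Jet p q → ℝ) (scale t z + s • (0, z.2)))
      (lineDeriv ℝ F (scale t z) (0, z.2)) (t - t) := by
      rw [sub_self]
      exact h
    have hs : ∀ s, scale s z = scale t z + (s - t) • ((0, z.2) : Jet p q) := fun s => by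
      refine Prod.ext ?_ ?_
      · simp [scale]
      · change s • z.2 = t • z.2 + (s - t) • z.2
        rw [← add_smul, add_sub_cancel]
    exact (h1.comp_sub_const t t).congr_of_eventuallyEq
      (Filter.Eventually.of_forall fun s => congrArg (F : Jet p q → ℝ) (hs s))
  have hint := fun α J => (integrable_comp_scale (coordD J α F) z).const_mul (z.2 J α)
  have hftc := intervalIntegral.integral_eq_sub_of_hasDerivAt (fun t _ => hderiv t)
    (a := 0) (b := 1) (by
      simp only [hvert]
      rw [intervalIntegrable_iff_integrableOn_Ioc_of_le zero_le_one]
      exact integrable_finsetSum _ fun α _ => integrable_finsetSum _ fun J _ => hint α J)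
  have h1 : scale 1 z = z := by simp [scale]
  rw [h1] at hftc
  rw [← hftc, intervalIntegral.integral_of_le zero_le_one]
  simp only [hvert]
  rw [integral_finsetSum _ fun α _ => integrable_finsetSum _ fun J _ => hint α J]
  refine Finset.sum_congr rfl fun α _ => ?_
  rw [integral_finsetSum _ fun J _ => hint α J]
  simp only [integral_const_mul]
  rfl

/-- Scaling is linear in the fibres and fixes the base, so it commutes with total derivatives;
averaging therefore passes through the whole Euler sum. -/
theorem sum_iterD_scaleMean (F : LocalFun p q) {S : Finset (Fin p → ℕ)}
    (hS : ∀ J ∉ S, ∀ α, coordD J α F = 0) (α : Fin q) (z : Jet p q) :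
    ∑ J ∈ S, (-1) ^ (∑ i, J i) * (iterD J (scaleMean (coordD J α F)) : Jet p q → ℝ) z
      = ∫ t in Set.Ioc (0 : ℝ) 1, euler α F (scale t z) := by
  have h : ∀ z, euler α F z
      = ∑ J ∈ S, (-1) ^ (∑ i, J i) * (iterD J (coordD J α F) : Jet p q → ℝ) z := fun z => by
    rw [euler_coe]
    refine finsum_eq_sum_of_support_subset _ fun J hJ => ?_
    by_contra h
    exact hJ (by simp [hS J h α])
  simp only [h]
  rw [integral_finsetSum _ fun J _ => (integrable_comp_scale _ z).const_mul _]
  simp only [integral_const_mul, iterD_scaleMean]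
  rfl

/-- A smooth function of the base point is a derivative with respect to any coordinate. -/
theorem exists_totalD_eq_comp_scale_zero (i : Fin p) (F : LocalFun p q) :
    ∃ A : LocalFun p q, ∀ z, (totalD i A : Jet p q → ℝ) z = (F : Jet p q → ℝ) (scale 0 z) := by
  obtain ⟨F, k, f, hf, rfl⟩ := F
  -- The antiderivative of f(x,0) in x^i is written as x^i ∫_0^1 f(…, t x^i, …, 0) dt, so that the
  -- fixed unit interval allows the parameter-integral results to give its smoothness.
  have hg : ContDiff ℝ ∞ fun w : FinJet p q k × ℝ =>
      f (Function.update w.1.1 i (w.2 * w.1.1 i), 0) := by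
    refine hf.comp (ContDiff.prodMk (contDiff_pi.2 fun j => ?_) contDiff_const)
    simp only [Function.update_apply]
    split_ifs <;> fun_prop
  have hA := (isLocal_base i).mul ((isParamLocal_unit_interval (p := p) (q := q)
    hg).isLocal_integral (c := fun t : ℝ => t) aestronglyMeasurable_id)
  refine ⟨⟨_, hA⟩, fun z => (hA.totalDeriv_apply i z).trans ?_⟩
  set h : ℝ → ℝ := fun s => f (Function.update z.1 i s, 0) with hh
  have hcont : Continuous h := by
    have h1 : Continuous fun s : ℝ => Function.update z.1 i s :=
      continuous_const.update i continuous_id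
    exact hf.continuous.comp (h1.prodMk continuous_const)
  -- Rescaling the variable restores the moving upper limit, to which the fundamental theorem
  -- applies.
  have hline : (fun s : ℝ => ((fun z : Jet p q => z.1 i) * fun z : Jet p q =>
      ∫ t in Set.Ioc (0 : ℝ) 1, f (Function.update (trunc k z).1 i (t * (trunc k z).1 i), 0)
        : Jet p q → ℝ) (z + s • dirX i z))
      = fun s => ∫ t in (0 : ℝ)..(z.1 i + s), h t := by
    funext s
    have h1 : (z + s • dirX i z).1 = Function.update z.1 i (z.1 i + s) := by
      funext j
      by_cases hj : j = i
      · subst hj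
        simp [dirX]
      · simp [dirX, hj]
    simp only [Pi.mul_apply, trunc, h1, Function.update_self, Function.update_idem]
    rw [← intervalIntegral.integral_of_le zero_le_one]
    have := intervalIntegral.mul_integral_comp_mul_right (f := h) (c := z.1 i + s) (a := 0) (b := 1)
    simpa only [zero_mul, one_mul] using this
  have hd : HasDerivAt (fun s => ∫ t in (0 : ℝ)..(z.1 i + s), h t) (h (z.1 i + 0)) 0 :=
    HasDerivAt.comp_const_add (z.1 i) 0
      (intervalIntegral.integral_hasDerivAt_right (hcont.intervalIntegrable _ _)
        (hcont.stronglyMeasurableAtFilter _ _) hcont.continuousAt)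
  rw [lineDeriv]
  refine (congrArg (fun u : ℝ → ℝ => deriv u 0) hline).trans (hd.deriv.trans ?_)
  simp only [hh, add_zero, Function.update_eq_self, scale, trunc, zero_smul]
  rfl

theorem isTotalDivOver_of_forall_eq {Ω : Set (Fin p → ℝ)} {F : Jet p q → ℝ}
    (P : Fin p → LocalFun p q)
    (h : ∀ z : Jet p q, z.1 ∈ Ω → F z = ∑ i, (totalD i (P i) : Jet p q → ℝ) z) :
    IsTotalDivOver Ω F := by
  choose k hk using fun i => (P i).2.exists_order
  choose f hf hPf using fun i => hk i _ (Finset.le_sup (f := k) (Finset.mem_univ i))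
  refine ⟨_, f, fun i => (hf i).contDiffOn, fun z hz => (h z hz).trans ?_⟩
  exact Finset.sum_congr rfl fun i _ => congrArg (fun G => totalDeriv i G z) (hPf i)

/-- A local function annihilated by the Euler operator over `Ω` is a total divergence there. -/
theorem isTotalDivOver_of_euler_eq_zero (hp : 0 < p) {Ω : Set (Fin p → ℝ)} (G : LocalFun p q)
    (hG : ∀ (α : Fin q) (z : Jet p q), z.1 ∈ Ω → euler α G z = 0) :
    IsTotalDivOver Ω (G : Jet p q → ℝ) := by
  obtain ⟨S, hS⟩ := LocalFun.exists_finset G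
  obtain ⟨A, hA⟩ := exists_totalD_eq_comp_scale_zero ⟨0, hp⟩ G
  choose Q hQ using fun J α => exists_coord_mul_eq J α (scaleMean (coordD J α G))
  refine isTotalDivOver_of_forall_eq
    -- The antiderivative of G(x,0) goes into the first component; the `Q J α` are the boundary
    -- terms of the integrations by parts.
    (fun i => (if i = ⟨0, hp⟩ then A else 0) + ∑ α, ∑ J ∈ S, Q J α i) fun z hz => ?_
  have hterm : ∀ J α, z.2 J α * (scaleMean (coordD J α G) : Jet p q → ℝ) z
      = z.2 0 α * ((-1) ^ (∑ i, J i)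
          * (iterD J (scaleMean (coordD J α G)) : Jet p q → ℝ) z)
        + ∑ i, (totalD i (Q J α i) : Jet p q → ℝ) z := fun J α => by
    have h := congrFun (congrArg Subtype.val (hQ J α)) z
    refine h.trans ?_
    change ((-1) ^ (∑ i, J i) * (z.2 0 α * _)
      + (((∑ i, totalD i (Q J α i) : LocalFun p q) : Jet p q → ℝ) z) : ℝ) = _
    rw [AddSubmonoidClass.coe_finsetSum, Finset.sum_apply]
    ring
  have hzero : ∀ α, ∑ J ∈ S, z.2 0 α * ((-1) ^ (∑ i, J i)
      * (iterD J (scaleMean (coordD J α G)) : Jet p q → ℝ) z) = 0 := fun α => by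
    rw [← Finset.mul_sum, sum_iterD_scaleMean G hS]
    -- Scaling does not move the base point, so the whole ray stays over Ω.
    simp [hG α (scale _ z) hz]
  have hsub := sub_comp_scale_zero G hS z
  simp only [hterm, Finset.sum_add_distrib, hzero, zero_add] at hsub
  have hfirst : ∑ i, (totalD i (if i = ⟨0, hp⟩ then A else 0) : Jet p q → ℝ) z
      = (G : Jet p q → ℝ) (scale 0 z) := by
    rw [Finset.sum_eq_single ⟨0, hp⟩ (fun j _ hj => by rw [if_neg hj, map_zero]; rfl) (by simp),
      if_pos rfl, hA]
  have hsecond : ∑ i, (totalD i (∑ α, ∑ J ∈ S, Q J α i) : Jet p q → ℝ) z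
      = ∑ α, ∑ J ∈ S, ∑ i, (totalD i (Q J α i) : Jet p q → ℝ) z := by
    simp only [map_sum, AddSubmonoidClass.coe_finsetSum, Finset.sum_apply]
    rw [Finset.sum_comm]
    exact Finset.sum_congr rfl fun α _ => Finset.sum_comm
  simp only [map_add]
  change _ = ∑ i, ((_ : ℝ) + _)
  rw [Finset.sum_add_distrib, hfirst, hsecond, ← hsub]
  ring

end Homotopy

/-! ### Partial integrals along admissible fields -/

section Fields

variable {Ω : Set (Fin p → ℝ)} {φ : (Fin p → ℝ) → Fin q → ℝ}

theorem contDiffOn_partialDeriv (hΩ : IsOpen Ω) (hφ : ContDiffOn ℝ ∞ φ Ω) (i : Fin p) :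
    ContDiffOn ℝ ∞ (partialDeriv i φ) Ω := by
  have h := ((contDiffOn_infty_iff_fderiv_of_isOpen hΩ).1 hφ).2
  refine (h.clm_apply (contDiffOn_const (c := Pi.single i 1))).congr fun x hx => ?_
  exact ((hφ.differentiableOn (by simp)).differentiableAt (hΩ.mem_nhds hx)).lineDeriv_eq_fderiv

theorem continuousOn_trunc_prolong (hΩ : IsOpen Ω) (hφ : ContDiffOn ℝ ∞ φ Ω) (k : ℕ) :
    ContinuousOn (fun x => trunc k (prolong φ x)) Ω := by
  refine continuousOn_id.prodMk (continuousOn_pi.2 fun J => ContDiffOn.continuousOn (𝕜 := ℝ) (n := ∞) ?_)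
  refine iterOp_rel (T := partialDeriv) (S := partialDeriv) (a := φ) (b := φ)
    (R := fun ψ _ => ContDiffOn ℝ ∞ ψ Ω) ?_ J.1 hφ
  intro i ψ _ hψ
  exact contDiffOn_partialDeriv hΩ hψ i

/-- A partial integral of the Lagrangian is a total divergence exactly if the corresponding partial
integral of its Euler expressions vanishes. -/
theorem integral₂_euler₁_eq_zero_iff {n m : ℕ} (hp : 0 < p) (hΩ : IsOpen Ω)
    {L : FinJet p q n × FinJet p q m → ℝ} (hL : ContDiff ℝ ∞ L) (hφ : Admissible₂ Ω L φ) :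
    (∀ (α : Fin q) (z : Jet p q), z.1 ∈ Ω → integral₂ Ω φ (euler₁ α (lift L)) z = 0)
      ↔ IsTotalDivOver Ω (integral₂ Ω φ (lift L)) := by
  have hc : AEStronglyMeasurable (fun y => trunc m (prolong φ y)) (volume.restrict Ω) :=
    (continuousOn_trunc_prolong hΩ hφ.1 m).aestronglyMeasurable hΩ.measurableSet
  have hΦ : IsParamLocal (volume.restrict Ω) (fun y => trunc m (prolong φ y))
      (fun a (z : Jet p q) => L (trunc n z, a)) := by
    refine ⟨n, L, hL, fun r K hK => ?_, rfl⟩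
    obtain ⟨g, hg, hle⟩ := hφ.2 r K hK
    exact ⟨g, hg, ae_restrict_of_forall_mem hΩ.measurableSet hle⟩
  have heuler : ∀ (α : Fin q) (z : Jet p q),
      euler α (integral₂ Ω φ (lift L)) z = integral₂ Ω φ (euler₁ α (lift L)) z := fun α z =>
    hΦ.euler_integral hc α z
  simp only [← heuler]
  exact ⟨isTotalDivOver_of_euler_eq_zero hp ⟨_, hΦ.isLocal_integral hc⟩,
    fun h α z hz => h.euler_eq_zero hΩ α hz⟩

end Fields

end NonlocalLagrangian

end

theorem mainTheorem4 {p q n m : ℕ} (hp : 0 < p)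
    (Ω : Set (Fin p → ℝ)) (hΩ : IsOpen Ω)
    (L : NonlocalLagrangian.FinJet p q n × NonlocalLagrangian.FinJet p q m → ℝ)
    (hL : ContDiff ℝ ∞ L) :
    ((∀ φ : (Fin p → ℝ) → (Fin q → ℝ), NonlocalLagrangian.Admissible₂ Ω L φ →
        ∀ (α : Fin q) (z : NonlocalLagrangian.Jet p q), z.1 ∈ Ω →
          NonlocalLagrangian.integral₂ Ω φ
            (NonlocalLagrangian.euler₁ α (NonlocalLagrangian.lift L)) z = 0) ∧
      (∀ φ : (Fin p → ℝ) → (Fin q → ℝ), NonlocalLagrangian.Admissible₁ Ω L φ →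
        ∀ (α : Fin q) (w : NonlocalLagrangian.Jet p q), w.1 ∈ Ω →
          NonlocalLagrangian.integral₁ Ω φ
            (NonlocalLagrangian.euler₂ α (NonlocalLagrangian.lift L)) w = 0)) ↔
    ((∀ φ : (Fin p → ℝ) → (Fin q → ℝ), NonlocalLagrangian.Admissible₂ Ω L φ →
        NonlocalLagrangian.IsTotalDivOver Ω
          (NonlocalLagrangian.integral₂ Ω φ (NonlocalLagrangian.lift L))) ∧
      (∀ φ : (Fin p → ℝ) → (Fin q → ℝ), NonlocalLagrangian.Admissible₁ Ω L φ →
        NonlocalLagrangian.IsTotalDivOver Ω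
          (NonlocalLagrangian.integral₁ Ω φ (NonlocalLagrangian.lift L)))) := by
  -- Exchanging the arguments turns the statement about the first partial integral definitionally
  -- into the one about the second.
  have hswap : ContDiff ℝ ∞ fun w : NonlocalLagrangian.FinJet p q m ×
      NonlocalLagrangian.FinJet p q n => L (w.2, w.1) := hL.comp (contDiff_snd.prodMk contDiff_fst)
  refine and_congr (forall₂_congr fun φ hφ => ?_) (forall₂_congr fun φ hφ => ?_)
  · exact NonlocalLagrangian.integral₂_euler₁_eq_zero_iff hp hΩ hL hφ
  · exact NonlocalLagrangian.integral₂_euler₁_eq_zero_iff hp hΩ hswap hφ
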